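/- **Setting.** Let the lattice $\mathcal L$ be $\mathbb Z$ or a finite ring $\mathbb Z/N$. Each cell carries a finite-dimensional Hilbert space $W=\bigotimes_{j}W_j$ (a tensor product of subcells) with a product orthonormal basis containing the quiescent state $|q\rangle=\bigotimes_j|q_j\rangle$. $\mathcal H_{\mathcal C}$ is the $\ell^2$-completion of the span of the finite configurations (tensor products over the cells of basis states, all but finitely many equal to $|q\rangle$); for a finite lattice it is $\bigotimes_{x\in\mathcal L}W$. The advection with displacements $e_j\in\mathcal L$ is the unitary $$\sigma:\ \bigotimes_x\bigotimes_j|b^x_j\rangle\mapsto\bigotimes_x\bigotimes_j|b^{x+e_j}_j\rangle ,$$ and for a unitary $S$ on $W$, $\hat S$ denotes the unitary that applies $S$ to every cell; if $\mathcal L$ is infinite, $S$ must fix $|q\rangle$. *QLGA.* A unitary $G$ on the Hilbert space $\mathcal H_{\mathcal C}$ with cell space $W$ is (up to a local change of description) a quantum lattice gas automaton (QLGA) if there are finitely many finite-dimensional Hilbert spaces $V_1,\dots,V_d$, displacements $e_1,\dots,e_d\in\mathcal L$, a unitary isomorphism $T:W\to\bigotimes_jV_j$ and a unitary $S$ on $\bigotimes_jV_j$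 such that $\hat T\,G\,\hat T^{-1}=\hat S\sigma$, where $\hat T$ applies $T$ to every cell; if $\mathcal L$ is infinite, it is also required that $T|q\rangle$ is a pure tensor $\bigotimes_j|\tilde q_j\rangle$ of unit vectors and that $S$ fixes it. *Cell construction.* Given shifts $c_j\in\mathcal L$ (one for each subcell index $j$) and an integer $m\ge1$ (with $m\mid N$ if $\mathcal L=\mathbb Z/N$), the new cell $y$ consists of the subcells $j$ of the old cells $my+i+c_j$, for $0\le i<m$ and all $j$; here $y$ ranges over $\mathbb Z$, respectively $\mathbb Z/(N/m)$. Every evolution on the old lattice can be read as an evolution on the lattice of new cells. **Theorem.** Let $W=W_1\otimes W_2$ with $W_1=W_2=\mathbb C^2$ and $|q\rangle=|00\rangle$. Let $\sigma_1$ be the advection with displacements $(e_1,e_2)=(0,-1)$ and $\sigma_2$ the one with $(e_1,e_2)=(+1,0)$. Then there exist unitaries $S_1,S_2$ on $W$ that fix $|00\rangle$ such that the QCA with global evolution $$G=\hat S_2\,\sigma_2\,\hat S_1\,\sigma_1$$ is not equivalent to a QLGA for any cell construction: for $\mathcal L=\mathbb Z$, and all shifts $c_1,c_2$ and all $m\ge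 1$, the evolution $G$ expressed in the new cells is not a QLGA; and the same holds for $\mathcal L=\mathbb Z/N$, for all shifts and all $m\mid N$ with $m<N$ (i.e. unless the whole finite lattice is merged into one cell). In fact one can take, for all these lattices, $S_1=S_2=S$ with the symmetric unitary matrix $$S=\begin{pmatrix}1&0&0&0\\0&1/\sqrt2&i/\sqrt2&0\\0&i/\sqrt2&1/\sqrt2&0\\0&0&0&i\end{pmatrix}$$ in the basis $|00\rangle,|01\rangle,|10\rangle,|11\rangle$. -/

import Mathlib

open scoped Matrix

noncomputable section

namespace QCA

/-! Throughout, a cell Hilbert space `W` is given by the finite index set `B` of an orthonormal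
basis, the element `0 : B` labelling the quiescent basis state.  A cell that is a tensor product
of subcells `W_j`, each with basis `B j`, has the product basis `∀ j, B j`, and its quiescent
state is the pure tensor of the quiescent states of the subcells. -/

/-- The Hilbert space of finite configurations over the lattice `L` with cell basis `B`: the
`ℓ²`-completion of the span of the configurations `L →₀ B`, in which all but finitely many cells
are quiescent.  If `L` is finite this is the usual tensor product over all cells. -/
abbrev Space (L B : Type) [Zero B] : Type := lp (fun _ : L →₀ B => ℂ) 2

/-- The basis vector of a configuration. -/
def ket {L B : Type} [Zero B] (c : L →₀ B) : Space L B :=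
  letI := Classical.decEq (L →₀ B)
  lp.single 2 c (1 : ℂ)

theorem ket_apply {L B : Type} [Zero B] [DecidableEq (L →₀ B)] (c c' : L →₀ B) :
    ket c c' = if c' = c then 1 else 0 := by
  simp [ket, lp.single_apply, Pi.single_apply]

theorem span_ket {L B : Type} [Zero B] : (Submodule.span ℂ (Set.range (ket (L := L) (B := B)))).topologicalClosure
    = ⊤ := by
  classical
  rw [eq_top_iff]
  intro f _
  refine mem_closure_of_tendsto (lp.hasSum_single (p := 2) (by simp) f)
    (Filter.Eventually.of_forall fun s => ?_)
  refine Submodule.sum_mem _ fun c _ => ?_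
  have h : lp.single (E := fun _ : L →₀ B => ℂ) 2 c (f c) = (f c) • ket c := by
    ext c'
    simp [ket, lp.single_apply, Pi.single_apply]
  rw [h]
  exact Submodule.smul_mem _ _ (Submodule.subset_span ⟨c, rfl⟩)

/-- A unitary map from a cell space with basis `B` onto a cell space with basis `B'`. -/
structure CellUnitary (B B' : Type) [Fintype B] [Fintype B'] [DecidableEq B]
    [DecidableEq B'] where
  mat : Matrix B' B ℂ
  conjTranspose_mul : matᴴ * mat = 1
  mul_conjTranspose : mat * matᴴ = 1

/-- The matrix maps the quiescent state to the quiescent state. -/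
def FixesQuiescent {B B' : Type} [Zero B] [Zero B'] [DecidableEq B'] (M : Matrix B' B ℂ) : Prop :=
  ∀ b, M b 0 = if b = 0 then 1 else 0

/-- Matrix entry, between two configurations, of the operator acting as `M` on every cell. -/
def cellwiseEntry {L B B' : Type} [Zero B] [Zero B'] (M : Matrix B' B ℂ) (c' : L →₀ B')
    (c : L →₀ B) : ℂ :=
  ∏ᶠ x, M (c' x) (c x)

section Cellwise

variable {L B B' B'' : Type} [Fintype B] [Fintype B'] [Fintype B''] [DecidableEq B]
  [DecidableEq B'] [DecidableEq B''] [Zero B] [Zero B'] [Zero B'']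

theorem cellwiseEntry_eq_prod {M : Matrix B' B ℂ} {F : Finset L}
    (hF : FixesQuiescent M ∨ ∀ x, x ∈ F) {c' : L →₀ B'} {c : L →₀ B}
    (hc' : c'.support ⊆ F) (hc : c.support ⊆ F) :
    cellwiseEntry M c' c = ∏ x ∈ F, M (c' x) (c x) := by
  apply finprod_eq_prod_of_mulSupport_subset
  intro x hx
  by_contra hxF
  have h1 : c' x = 0 := Finsupp.notMem_support_iff.1 fun h => hxF (hc' h)
  have h2 : c x = 0 := Finsupp.notMem_support_iff.1 fun h => hxF (hc h)
  rcases hF with hF | hF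
  · exact hx (by simp [h1, h2, hF 0])
  · exact hxF (hF x)

theorem cellwiseEntry_eq_zero {M : Matrix B' B ℂ} {F : Finset L}
    (hF : FixesQuiescent M ∨ ∀ x, x ∈ F) {c' : L →₀ B'} {c : L →₀ B}
    (hc : c.support ⊆ F) (hc' : ¬ c'.support ⊆ F) : cellwiseEntry M c' c = 0 := by
  rcases hF with hF | hF
  · obtain ⟨x, hx, hxF⟩ := Finset.not_subset.1 hc'
    refine finprod_eq_zero _ x ?_ ?_
    · have h2 : c x = 0 := Finsupp.notMem_support_iff.1 fun h => hxF (hc h)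
      rw [h2, hF, if_neg (Finsupp.mem_support_iff.1 hx)]
    · refine ((c'.support.finite_toSet).union (c.support.finite_toSet)).subset ?_
      intro y hy
      by_contra h
      simp only [Set.mem_union, Finset.mem_coe, Finsupp.mem_support_iff, not_or, not_not] at h
      exact hy (by simp [h.1, h.2, hF 0])
  · exact absurd (fun x _ => hF x) hc'

theorem exists_good_finset {p : Prop} (h : Infinite L → p) (F₀ : Finset L) :
    ∃ F : Finset L, F₀ ⊆ F ∧ (p ∨ ∀ x, x ∈ F) := by
  rcases finite_or_infinite L with hL | hL
  · haveI := Fintype.ofFinite L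
    exact ⟨Finset.univ, Finset.subset_univ _, Or.inr Finset.mem_univ⟩
  · exact ⟨F₀, subset_rfl, Or.inl (h hL)⟩

/-- The configurations supported in a finite set of cells. -/
def configsOn (F : Finset L) (B : Type) [Fintype B] [Zero B] : Finset (L →₀ B) :=
  F.finsupp fun _ => Finset.univ

theorem mem_configsOn {F : Finset L} {c : L →₀ B} : c ∈ configsOn F B ↔ c.support ⊆ F := by
  simp [configsOn, Finset.mem_finsupp_iff]

theorem sum_configsOn_prod (F : Finset L) (g : L → B → ℂ) :
    ∑ c ∈ configsOn F B, ∏ x ∈ F, g x (c x) = ∏ x ∈ F, ∑ b, g x b := by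
  classical
  rw [Finset.prod_sum, configsOn, Finset.finsupp, Finset.sum_map]
  refine Finset.sum_congr rfl fun p hp => ?_
  rw [← Finset.prod_attach]
  refine Finset.prod_congr rfl fun x _ => ?_
  simp [Finsupp.indicator_of_mem x.2]

theorem sum_cellwiseEntry_mul {M : Matrix B' B ℂ} {M' : Matrix B'' B' ℂ} {F : Finset L}
    (hF : FixesQuiescent M ∨ ∀ x, x ∈ F) (hF' : FixesQuiescent M' ∨ ∀ x, x ∈ F)
    {c : L →₀ B} {c'' : L →₀ B''} (hc : c.support ⊆ F) (hc'' : c''.support ⊆ F) :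
    ∑ c' ∈ configsOn F B', cellwiseEntry M' c'' c' * cellwiseEntry M c' c
      = ∏ x ∈ F, (M' * M) (c'' x) (c x) := by
  simp only [Matrix.mul_apply]
  rw [← sum_configsOn_prod F fun x b => M' (c'' x) b * M b (c x)]
  refine Finset.sum_congr rfl fun c' hc' => ?_
  rw [mem_configsOn] at hc'
  rw [cellwiseEntry_eq_prod hF' hc'' hc', cellwiseEntry_eq_prod hF hc' hc,
    Finset.prod_mul_distrib]

theorem prod_one_apply {F : Finset L} {c c' : L →₀ B} (hc : c.support ⊆ F)
    (hc' : c'.support ⊆ F) [Decidable (c = c')] :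
    ∏ x ∈ F, (1 : Matrix B B ℂ) (c x) (c' x) = if c = c' then 1 else 0 := by
  split_ifs with h
  · subst h; simp
  · have : ∃ x, c x ≠ c' x := by
      by_contra! h'
      exact h (Finsupp.ext h')
    obtain ⟨x, hx⟩ := this
    refine Finset.prod_eq_zero (i := x) ?_ (Matrix.one_apply_ne hx)
    by_contra hxF
    exact hx (by rw [Finsupp.notMem_support_iff.1 fun h => hxF (hc h),
      Finsupp.notMem_support_iff.1 fun h => hxF (hc' h)])

theorem star_cellwiseEntry {M : Matrix B' B ℂ} {F : Finset L}
    (hF : FixesQuiescent M ∨ ∀ x, x ∈ F) (hF' : FixesQuiescent Mᴴ ∨ ∀ x, x ∈ F)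
    {c' : L →₀ B'} {c : L →₀ B} (hc' : c'.support ⊆ F) (hc : c.support ⊆ F) :
    star (cellwiseEntry M c' c) = cellwiseEntry Mᴴ c c' := by
  rw [cellwiseEntry_eq_prod hF hc' hc, cellwiseEntry_eq_prod hF' hc hc', star_prod]
  rfl

theorem CellUnitary.fixes_conjTranspose (U : CellUnitary B B') (h : FixesQuiescent U.mat) :
    FixesQuiescent U.matᴴ := by
  intro b
  have h1 : (U.matᴴ * U.mat) b 0 = (1 : Matrix B B ℂ) b 0 := by rw [U.conjTranspose_mul]
  rw [Matrix.mul_apply, Matrix.one_apply] at h1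
  rw [← h1]
  simp [h _]

/-- The image of a configuration under the operator acting as `M` on every cell. -/
def cellwiseKet (M : Matrix B' B ℂ) (h : Infinite L → FixesQuiescent M) (c : L →₀ B) :
    Space L B' :=
  ⟨fun c' => cellwiseEntry M c' c, by
    obtain ⟨F, hcF, hF⟩ := exists_good_finset h c.support
    have hfin : (Function.support fun c' : L →₀ B' => cellwiseEntry M c' c).Finite := by
      refine (configsOn F B').finite_toSet.subset fun c' hc' => ?_
      rw [Finset.mem_coe, mem_configsOn]
      by_contra hn
      exact hc' (cellwiseEntry_eq_zero hF hcF hn)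
    exact (memℓp_zero_iff.2 hfin).of_exponent_ge (by simp)⟩

theorem cellwiseKet_apply (M : Matrix B' B ℂ) (h : Infinite L → FixesQuiescent M) (c : L →₀ B)
    (c' : L →₀ B') : cellwiseKet M h c c' = cellwiseEntry M c' c := rfl

theorem orthonormal_cellwiseKet (U : CellUnitary B B')
    (h : Infinite L → FixesQuiescent U.mat) : Orthonormal ℂ (cellwiseKet (L := L) U.mat h) := by
  classical
  rw [orthonormal_iff_ite]
  intro c₁ c₂
  obtain ⟨F, hcF, hF⟩ := exists_good_finset h (c₁.support ∪ c₂.support)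
  have hc₁ := Finset.union_subset_left hcF
  have hc₂ := Finset.union_subset_right hcF
  have hF' : FixesQuiescent U.matᴴ ∨ ∀ x, x ∈ F := hF.imp_left U.fixes_conjTranspose
  rw [lp.inner_eq_tsum, tsum_eq_sum (s := configsOn F B')]
  · rw [← prod_one_apply hc₁ hc₂, ← U.conjTranspose_mul, ← sum_cellwiseEntry_mul hF hF' hc₂ hc₁]
    refine Finset.sum_congr rfl fun c' hc' => ?_
    rw [mem_configsOn] at hc'
    rw [← star_cellwiseEntry hF hF' hc' hc₁, cellwiseKet_apply, cellwiseKet_apply,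
      RCLike.inner_apply, mul_comm]
    rfl
  · intro c' hc'
    rw [mem_configsOn] at hc'
    rw [cellwiseKet_apply, cellwiseEntry_eq_zero hF hc₁ hc', inner_zero_left]

theorem top_le_span_cellwiseKet (U : CellUnitary B B')
    (h : Infinite L → FixesQuiescent U.mat) :
    ⊤ ≤ (Submodule.span ℂ (Set.range (cellwiseKet (L := L) U.mat h))).topologicalClosure := by
  classical
  rw [← span_ket]
  refine Submodule.topologicalClosure_mono (Submodule.span_le.2 ?_)
  rintro _ ⟨c₀, rfl⟩
  obtain ⟨F, hcF, hF⟩ := exists_good_finset h c₀.support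
  have hF' : FixesQuiescent U.matᴴ ∨ ∀ x, x ∈ F := hF.imp_left U.fixes_conjTranspose
  have key : ket c₀ = ∑ c ∈ configsOn F B, cellwiseEntry U.matᴴ c c₀ • cellwiseKet U.mat h c := by
    ext c'
    rw [lp.coeFn_sum, Finset.sum_apply]
    simp only [lp.coeFn_smul, Pi.smul_apply, cellwiseKet_apply, smul_eq_mul]
    by_cases hc' : c'.support ⊆ F
    · have e := sum_cellwiseEntry_mul hF' hF hcF hc'
      rw [U.mul_conjTranspose, prod_one_apply hc' hcF] at e
      simp_rw [mul_comm (cellwiseEntry U.matᴴ _ c₀)]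
      rw [e]
      simp [ket, lp.single_apply, Pi.single_apply]
    · rw [Finset.sum_eq_zero]
      · have : c' ≠ c₀ := by rintro rfl; exact hc' hcF
        simp [ket_apply, this]
      · intro c hc
        rw [mem_configsOn] at hc
        rw [cellwiseEntry_eq_zero hF hc hc', mul_zero]
  rw [key]
  exact Submodule.sum_mem _ fun c _ => Submodule.smul_mem _ _ (Submodule.subset_span ⟨c, rfl⟩)

/-- The unitary operator `Û` that acts as `U` on every cell.  On an infinite lattice `U` has to
preserve the quiescent state. -/
def cellwise (U : CellUnitary B B') (h : Infinite L → FixesQuiescent U.mat) :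
    Space L B ≃ₗᵢ[ℂ] Space L B' :=
  (HilbertBasis.mk (orthonormal_cellwiseKet U h) (top_le_span_cellwiseKet U h)).repr.symm

theorem cellwise_ket (U : CellUnitary B B') (h : Infinite L → FixesQuiescent U.mat)
    (c : L →₀ B) (c' : L →₀ B') :
    cellwise U h (ket c) c' = ∏ᶠ x, U.mat (c' x) (c x) := by
  classical
  have e : ket c = lp.single (E := fun _ : L →₀ B => ℂ) 2 c (1 : ℂ) := by
    ext c'
    simp [ket, lp.single_apply, Pi.single_apply]
  rw [cellwise, e, HilbertBasis.repr_symm_single, HilbertBasis.coe_mk]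
  rfl

end Cellwise

section Relabel

variable {L L' B B' : Type} [Zero B] [Zero B']

theorem orthonormal_ket_comp (e : (L →₀ B) ≃ (L' →₀ B')) :
    Orthonormal ℂ fun c => ket (e c) := by
  classical
  rw [orthonormal_iff_ite]
  intro c₁ c₂
  have h : ket (e c₁) = lp.single (E := fun _ : L' →₀ B' => ℂ) 2 (e c₁) (1 : ℂ) := by
    ext c'
    simp [ket, lp.single_apply, Pi.single_apply]
  rw [h, lp.inner_single_left, ket_apply]
  simp

theorem top_le_span_ket_comp (e : (L →₀ B) ≃ (L' →₀ B')) :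
    ⊤ ≤ (Submodule.span ℂ (Set.range fun c => ket (e c))).topologicalClosure := by
  have h : (Set.range fun c => ket (e c)) = Set.range (ket (L := L') (B := B')) :=
    e.surjective.range_comp ket
  rw [h, span_ket]

/-- The unitary operator that maps the basis vector of `c` to the basis vector of `e c`. -/
def relabel (e : (L →₀ B) ≃ (L' →₀ B')) : Space L B ≃ₗᵢ[ℂ] Space L' B' :=
  (HilbertBasis.mk (orthonormal_ket_comp e) (top_le_span_ket_comp e)).repr.symm

theorem relabel_ket (e : (L →₀ B) ≃ (L' →₀ B')) (c : L →₀ B) :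
    relabel e (ket c) = ket (e c) := by
  classical
  have h : ket c = lp.single (E := fun _ : L →₀ B => ℂ) 2 c (1 : ℂ) := by
    ext c'
    simp [ket, lp.single_apply, Pi.single_apply]
  rw [relabel, h, HilbertBasis.repr_symm_single, HilbertBasis.coe_mk]

end Relabel

section Advection

variable {L J : Type} [AddCommGroup L] [Finite J] {B : J → Type} [∀ j, Zero (B j)]

/-- The action of an advection on configurations: subcell `j` of cell `x` receives the content of
subcell `j` of cell `x + e j`. -/
def advectConfig (e : J → L) (c : L →₀ ∀ j, B j) : L →₀ ∀ j, B j :=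
  Finsupp.ofSupportFinite (fun x j => c (x + e j) j) <| by
    refine (Set.finite_iUnion fun j : J =>
      c.support.finite_toSet.preimage (add_left_injective (e j)).injOn).subset fun x hx => ?_
    rw [Function.mem_support, Function.ne_iff] at hx
    obtain ⟨j, hj⟩ := hx
    refine Set.mem_iUnion.2 ⟨j, ?_⟩
    rw [Set.mem_preimage, Finset.mem_coe, Finsupp.mem_support_iff]
    intro h0
    exact hj (congrFun h0 j)

theorem advectConfig_apply (e : J → L) (c : L →₀ ∀ j, B j) (x : L) (j : J) :
    advectConfig e c x j = c (x + e j) j := rfl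

/-- The advection `σ` that belongs to the neighborhood `{e j}`. -/
def advection (e : J → L) : Space L (∀ j, B j) ≃ₗᵢ[ℂ] Space L (∀ j, B j) :=
  relabel
    { toFun := advectConfig e
      invFun := advectConfig fun j => -e j
      left_inv := fun c => by
        ext x j
        simp [advectConfig_apply]
      right_inv := fun c => by
        ext x j
        simp [advectConfig_apply] }

end Advection

/-- A QLGA on the lattice `L`: finitely many subcells `W_j`, of dimension `k j + 1`, with scattering
`S` and advection given by `e`, so that one time step is `Ŝ σ`.  The evolution `G`, whose cell space
has basis `B`, is a QLGA if it is of this form after a unitary identification `T` of its cell space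
with the tensor product of the `W_j`. On an infinite lattice `T` maps the quiescent state of `G` to
that of the QLGA, which is a pure tensor, and `S` fixes it. -/
def IsQLGA {L B : Type} [AddCommGroup L] [Fintype B] [DecidableEq B] [Zero B]
    (G : Space L B ≃ₗᵢ[ℂ] Space L B) : Prop :=
  ∃ (d : ℕ) (k : Fin d → ℕ) (e : Fin d → L)
    (T : CellUnitary B (∀ j, Fin (k j + 1)))
    (S : CellUnitary (∀ j, Fin (k j + 1)) (∀ j, Fin (k j + 1)))
    (hT : Infinite L → FixesQuiescent T.mat) (hS : Infinite L → FixesQuiescent S.mat),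
    ∀ ψ, cellwise T hT (G ψ) = cellwise S hS (advection e (cellwise T hT ψ))

/-- A cell construction on the lattice `ZMod N` (which is `ℤ` for `N = 0`) with subcells `J`: the
new cells are obtained by shifting the subcells of type `j` by `c j`, and then grouping `m`
consecutive cells.  The lattice of the new cells is `ZMod K`, where `N = m * K`. -/
structure CellConstruction (N : ℕ) (J : Type) where
  c : J → ZMod N
  m : ℕ
  m_pos : 0 < m
  K : ℕ
  eq_mul : N = m * K

namespace CellConstruction

variable {N : ℕ} {J : Type} (C : CellConstruction N J)

/-- The point `m y + i` of the old lattice, for `0 ≤ i < m`.  The coercion of `y` to an integer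
is the identity if `K = 0`, and the representative in `[0, K)` otherwise. -/
def site (p : ZMod C.K × Fin C.m) : ZMod N :=
  (((C.m : ℤ) * (p.1.cast : ℤ) + ((p.2 : ℕ) : ℤ) : ℤ) : ZMod N)

theorem site_bijective : Function.Bijective C.site := by
  obtain ⟨c, m, hm, K, rfl⟩ := C
  constructor
  · rintro ⟨y, i⟩ ⟨y', i'⟩ h
    have h1 := (ZMod.intCast_eq_intCast_iff_dvd_sub _ _ _).1 h
    simp only [Nat.cast_mul] at h1
    obtain ⟨t, ht⟩ := h1
    have hi := i.2
    have hi' := i'.2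
    simp only at hi hi'
    have h2 : (m : ℤ) * (y'.cast - y.cast - K * t) = ((i : ℕ) : ℤ) - ((i' : ℕ) : ℤ) := by
      linear_combination ht
    have h3 : ((i : ℕ) : ℤ) - ((i' : ℕ) : ℤ) = 0 :=
      Int.eq_zero_of_abs_lt_dvd (Dvd.intro _ h2) (by rw [abs_lt]; constructor <;> omega)
    have h4 : i = i' := Fin.ext (by omega)
    rw [h3] at h2
    have h5 : (y'.cast - y.cast - K * t : ℤ) = 0 := by
      rcases mul_eq_zero.1 h2 with h | h
      · omega
      · exact h
    have h6 : ((y.cast : ℤ) : ZMod K) = ((y'.cast : ℤ) : ZMod K) :=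
      (ZMod.intCast_eq_intCast_iff_dvd_sub _ _ _).2 ⟨t, by linear_combination h5⟩
    rw [ZMod.intCast_zmod_cast, ZMod.intCast_zmod_cast] at h6
    rw [h4, h6]
  · intro x
    have hm' : (0 : ℤ) < m := by exact_mod_cast hm
    have h0 := Int.emod_nonneg (x.cast : ℤ) hm'.ne'
    have h1 := Int.emod_lt_of_pos (x.cast : ℤ) hm'
    refine ⟨(((x.cast / m : ℤ) : ZMod K), ⟨((x.cast : ℤ) % m).toNat, by simp only; omega⟩), ?_⟩
    have h2 : (K : ℤ) ∣ (x.cast / m : ℤ) - (((x.cast / m : ℤ) : ZMod K).cast : ℤ) := by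
      rw [← ZMod.intCast_eq_intCast_iff_dvd_sub, ZMod.intCast_zmod_cast]
    obtain ⟨t, ht⟩ := h2
    conv_rhs => rw [← ZMod.intCast_zmod_cast x]
    refine (ZMod.intCast_eq_intCast_iff_dvd_sub _ _ _).2 ⟨t, ?_⟩
    simp only [Int.toNat_of_nonneg h0]
    have h3 := Int.mul_ediv_add_emod (x.cast : ℤ) m
    push_cast
    linear_combination (m : ℤ) * ht - h3

/-- The lattice points, as pairs of a new cell and a position in its block. -/
def siteEquiv : ZMod C.K × Fin C.m ≃ ZMod N :=
  Equiv.ofBijective C.site C.site_bijective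

variable [Finite J] {B : J → Type} [∀ j, Zero (B j)]

/-- A configuration of the old cells, read as one of the new cells: the new cell `y` consists of
the subcells `j` of the old cells `m y + i + c j`, for `0 ≤ i < m`. -/
def regroupConfig (f : ZMod N →₀ ∀ j, B j) : ZMod C.K →₀ ∀ p : Fin C.m × J, B p.2 :=
  Finsupp.ofSupportFinite (fun y p => f (C.site (y, p.1) + C.c p.2) p.2) <| by
    refine (Set.finite_iUnion fun p : Fin C.m × J => f.support.finite_toSet.preimage
      (f := fun y => C.site (y, p.1) + C.c p.2) ?_).subset fun y hy => ?_
    · intro y _ y' _ h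
      have h' := C.site_bijective.1 (add_right_cancel h)
      exact congrArg Prod.fst h'
    · rw [Function.mem_support, Function.ne_iff] at hy
      obtain ⟨p, hp⟩ := hy
      refine Set.mem_iUnion.2 ⟨p, ?_⟩
      rw [Set.mem_preimage, Finset.mem_coe, Finsupp.mem_support_iff]
      intro h0
      exact hp (congrFun h0 p.2)

/-- The inverse of `regroupConfig`. -/
def ungroupConfig (g : ZMod C.K →₀ ∀ p : Fin C.m × J, B p.2) : ZMod N →₀ ∀ j, B j :=
  Finsupp.ofSupportFinite (fun x j => g (C.siteEquiv.symm (x - C.c j)).1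
      ((C.siteEquiv.symm (x - C.c j)).2, j)) <| by
    refine (Set.finite_iUnion fun j : J => (g.support.finite_toSet.prod
      (Set.finite_univ (α := Fin C.m))).preimage
      (f := fun x => C.siteEquiv.symm (x - C.c j)) ?_).subset fun x hx => ?_
    · intro x _ x' _ h
      exact sub_left_injective (C.siteEquiv.symm.injective h)
    · rw [Function.mem_support, Function.ne_iff] at hx
      obtain ⟨j, hj⟩ := hx
      refine Set.mem_iUnion.2 ⟨j, ?_, Set.mem_univ _⟩
      rw [Finset.mem_coe, Finsupp.mem_support_iff]
      intro h0
      exact hj (congrFun h0 _)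

/-- The unitary identification of the Hilbert space over the old cells with the one over the new
cells. -/
def regroup : Space (ZMod N) (∀ j, B j) ≃ₗᵢ[ℂ] Space (ZMod C.K) (∀ p : Fin C.m × J, B p.2) :=
  relabel
    { toFun := C.regroupConfig
      invFun := C.ungroupConfig
      left_inv := fun f => by
        ext x j
        have h : C.site (C.siteEquiv.symm (x - C.c j)) = x - C.c j :=
          C.siteEquiv.apply_symm_apply _
        change f (C.site (C.siteEquiv.symm (x - C.c j)) + C.c j) j = f x j
        rw [h, sub_add_cancel]
      right_inv := fun g => by
        ext y p
        change g (C.siteEquiv.symm (C.siteEquiv (y, p.1) + C.c p.2 - C.c p.2)).1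
          ((C.siteEquiv.symm (C.siteEquiv (y, p.1) + C.c p.2 - C.c p.2)).2, p.2) = g y p
        rw [add_sub_cancel_right, Equiv.symm_apply_apply] }

/-- The evolution `G`, expressed in the new cells. -/
def evolution (G : Space (ZMod N) (∀ j, B j) ≃ₗᵢ[ℂ] Space (ZMod N) (∀ j, B j)) :
    Space (ZMod C.K) (∀ p : Fin C.m × J, B p.2) ≃ₗᵢ[ℂ]
      Space (ZMod C.K) (∀ p : Fin C.m × J, B p.2) :=
  (C.regroup.symm.trans G).trans C.regroup

end CellConstruction

/-- The basis `|b₁ b₂⟩` of a cell that is a pair of qubits, `W₁ = W₂ = ℂ²`. -/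
abbrev QubitPair : Type := ∀ _ : Fin 2, Fin 2

/-- The position of `|b₁ b₂⟩` in the order `|00⟩, |01⟩, |10⟩, |11⟩`. -/
def QubitPair.index (b : QubitPair) : Fin 4 :=
  ⟨2 * (b 0 : ℕ) + (b 1 : ℕ), by omega⟩

/-- The global evolution `G = Ŝ₂ σ₂ Ŝ₁ σ₁` on the lattice `ZMod N` (which is `ℤ` for `N = 0`), where
the advections `σ₁`, `σ₂` have the neighborhoods `{0, -1}` and `{+1, 0}`. -/
def twoLayer (N : ℕ) (S₁ S₂ : CellUnitary QubitPair QubitPair) (h₁ : FixesQuiescent S₁.mat)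
    (h₂ : FixesQuiescent S₂.mat) :
    Space (ZMod N) QubitPair ≃ₗᵢ[ℂ] Space (ZMod N) QubitPair :=
  (((advection ![0, -1]).trans (cellwise S₁ fun _ => h₁)).trans (advection ![1, 0])).trans
    (cellwise S₂ fun _ => h₂)

/-- The symmetric scattering matrix `S`, in the order `|00⟩, |01⟩, |10⟩, |11⟩`. -/
def scatteringMatrix : Matrix QubitPair QubitPair ℂ :=
  (!![1, 0, 0, 0;
      0, 1 / (√2 : ℝ), Complex.I / (√2 : ℝ), 0;
      0, Complex.I / (√2 : ℝ), 1 / (√2 : ℝ), 0;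
      0, 0, 0, Complex.I] : Matrix (Fin 4) (Fin 4) ℂ).submatrix QubitPair.index QubitPair.index

end QCA

end

open scoped Matrix

noncomputable section

namespace QCA

/-! ### Coordinates of vectors and operators in the configuration basis. -/

section Kets

variable {L B B' : Type} [Zero B] [Zero B']

/-! The obstruction is a bilinear condition on single-cell excitations. In a lattice gas the
backward evolution of an excitation of the cell `Y` sits in the subcells that the advection carries
to `Y`, and different cells have disjoint sets of such subcells. Inside any cell `X`, the backward
images of excitations of `Y ≠ Y'` are thus excited in different tensor factors and have zero
`overlap` (`IsQLGA.overlap_symm_eq_zero`). The inverse of a QLGA is again a QLGA (`IsQLGA.symm`), so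
the same holds forward.

On an infinite lattice the quiescent state is a product by definition. On a finite one `T` may send
it to an entangled state of the subcells; but the evolution at hand fixes the vacuum, which is
therefore a product over cells both before and after advection, and this makes each cell state
factor along the advection groups (`mul_eq_of_prod_mix`). Exchanging one group between two copies of
the system (`kernelForm_exchange`) then factors the overlap into two overlaps with the vacuum, one
of which vanishes.

For the model, the two conditions are evaluated on one-particle states, where the evolution is an
explicit quantum walk. They become linear equations between indicators of which subcells lie in a
new cell (`occupation_eq_of_symm`, `occupation_eq`). At a boundary between two new cells, one of
them fails. -/

theorem ket_eq_single [DecidableEq (L →₀ B)] (c : L →₀ B) :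
    ket c = lp.single (E := fun _ : L →₀ B => ℂ) 2 c (1 : ℂ) := by
  ext c'
  simp [ket_apply, lp.single_apply, Pi.single_apply]

theorem inner_ket_left (c : L →₀ B) (ψ : Space L B) : inner ℂ (ket c) ψ = ψ c := by
  classical
  rw [ket_eq_single, lp.inner_single_left]
  simp

theorem Space.sum_apply {ι : Type*} (s : Finset ι) (f : ι → Space L B) (c : L →₀ B) :
    (∑ i ∈ s, f i) c = ∑ i ∈ s, f i c := by
  simp only [← inner_ket_left, inner_sum]

theorem Space.add_apply (ψ φ : Space L B) (c : L →₀ B) : (ψ + φ) c = ψ c + φ c := by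
  simp only [← inner_ket_left, inner_add_right]

theorem Space.smul_apply (z : ℂ) (ψ : Space L B) (c : L →₀ B) : (z • ψ) c = z * ψ c := by
  simp only [← inner_ket_left, inner_smul_right]

/-- Unitary operators that agree on all basis vectors are equal. -/
theorem eq_of_forall_ket {U V : Space L B ≃ₗᵢ[ℂ] Space L B'}
    (h : ∀ c, U (ket c) = V (ket c)) : U = V := by
  have hd : Dense (Submodule.span ℂ (Set.range (ket (L := L) (B := B))) : Set (Space L B)) :=
    Submodule.dense_iff_topologicalClosure_eq_top.2 span_ket
  have e : (U.toContinuousLinearEquiv : Space L B →L[ℂ] Space L B')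
      = V.toContinuousLinearEquiv := by
    refine ContinuousLinearMap.ext_on hd ?_
    rintro _ ⟨c, rfl⟩
    exact h c
  ext1 ψ
  exact congrArg (fun f : Space L B →L[ℂ] Space L B' => f ψ) e

theorem symm_ket_apply (U : Space L B ≃ₗᵢ[ℂ] Space L B) (c c' : L →₀ B) :
    U.symm (ket c) c' = star (U (ket c') c) := by
  rw [← inner_ket_left, ← inner_ket_left, ← U.inner_map_map, U.apply_symm_apply,
    ← inner_conj_symm]
  rfl

theorem relabel_symm_apply {L' : Type} (e : (L →₀ B) ≃ (L' →₀ B')) (ψ : Space L' B')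
    (c : L →₀ B) : (relabel e).symm ψ c = ψ (e c) := by
  rw [← inner_ket_left, ← (relabel e).inner_map_map, relabel_ket,
    LinearIsometryEquiv.apply_symm_apply, inner_ket_left]

end Kets

/-! ### Composition and inversion of cellwise unitaries. -/

section Cellwise

variable {L B B' B'' : Type} [Fintype B] [Fintype B'] [Fintype B''] [DecidableEq B]
  [DecidableEq B'] [DecidableEq B''] [Zero B] [Zero B'] [Zero B'']

/-- The composition of two unitary maps between cell spaces. -/
def CellUnitary.comp (V : CellUnitary B' B'') (U : CellUnitary B B') : CellUnitary B B'' where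
  mat := V.mat * U.mat
  conjTranspose_mul := by
    rw [Matrix.conjTranspose_mul, Matrix.mul_assoc, ← Matrix.mul_assoc V.matᴴ,
      V.conjTranspose_mul, Matrix.one_mul, U.conjTranspose_mul]
  mul_conjTranspose := by
    rw [Matrix.conjTranspose_mul, Matrix.mul_assoc, ← Matrix.mul_assoc U.mat,
      U.mul_conjTranspose, Matrix.one_mul, V.mul_conjTranspose]

/-- The inverse of a unitary map between cell spaces. -/
def CellUnitary.symm (U : CellUnitary B B') : CellUnitary B' B where
  mat := U.matᴴ
  conjTranspose_mul := by rw [Matrix.conjTranspose_conjTranspose, U.mul_conjTranspose]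
  mul_conjTranspose := by rw [Matrix.conjTranspose_conjTranspose, U.conjTranspose_mul]

theorem FixesQuiescent.mul {M : Matrix B' B ℂ} {M' : Matrix B'' B' ℂ} (h' : FixesQuiescent M')
    (h : FixesQuiescent M) : FixesQuiescent (M' * M) := by
  intro b
  rw [Matrix.mul_apply, ← h' b]
  simp [h _]

theorem FixesQuiescent.comp {V : CellUnitary B' B''} {U : CellUnitary B B'}
    (hV : FixesQuiescent V.mat) (hU : FixesQuiescent U.mat) : FixesQuiescent (V.comp U).mat :=
  hV.mul hU

theorem FixesQuiescent.symm {U : CellUnitary B B'} (hU : FixesQuiescent U.mat) :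
    FixesQuiescent U.symm.mat :=
  U.fixes_conjTranspose hU

theorem cellwise_ket_apply (U : CellUnitary B B') (h : Infinite L → FixesQuiescent U.mat)
    (c : L →₀ B) (c' : L →₀ B') : cellwise U h (ket c) c' = cellwiseEntry U.mat c' c :=
  cellwise_ket U h c c'

theorem cellwise_ket_eq_sum (U : CellUnitary B B') (h : Infinite L → FixesQuiescent U.mat)
    {F : Finset L} (hF : FixesQuiescent U.mat ∨ ∀ x, x ∈ F) {c : L →₀ B}
    (hc : c.support ⊆ F) :
    cellwise U h (ket c) = ∑ c' ∈ configsOn F B', cellwiseEntry U.mat c' c • ket c' := by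
  classical
  ext c'
  rw [Space.sum_apply, cellwise_ket_apply]
  simp only [Space.smul_apply, ket_apply, mul_ite, mul_one, mul_zero,
    Finset.sum_ite_eq]
  split_ifs with h'
  · rfl
  · exact cellwiseEntry_eq_zero hF hc fun h => h' (mem_configsOn.2 h)

theorem cellwise_comp (V : CellUnitary B' B'') (U : CellUnitary B B')
    (hV : Infinite L → FixesQuiescent V.mat) (hU : Infinite L → FixesQuiescent U.mat) :
    (cellwise U hU).trans (cellwise V hV) =
      cellwise (L := L) (V.comp U) fun h => (hV h).comp (hU h) := by
  classical
  refine eq_of_forall_ket fun c => ?_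
  ext c''
  obtain ⟨F, hcF, hF⟩ := exists_good_finset (p := FixesQuiescent U.mat ∧ FixesQuiescent V.mat)
    (fun h => ⟨hU h, hV h⟩) (c.support ∪ c''.support)
  have hc := Finset.union_subset_left hcF
  have hc'' := Finset.union_subset_right hcF
  have hFU := hF.imp_left And.left
  have hFV := hF.imp_left And.right
  -- Outside `F` everything is quiescent, so the sum over intermediate configurations is finite and
  -- factors into matrix products cell by cell.
  rw [LinearIsometryEquiv.trans_apply, cellwise_ket_eq_sum U hU hFU hc, map_sum,
    Space.sum_apply, cellwise_ket_apply, cellwiseEntry_eq_prod (F := F) ?_ hc'' hc]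
  · change _ = ∏ x ∈ F, (V.mat * U.mat) (c'' x) (c x)
    rw [← sum_cellwiseEntry_mul hFU hFV hc hc'']
    refine Finset.sum_congr rfl fun c' _ => ?_
    rw [map_smul, Space.smul_apply, cellwise_ket_apply, mul_comm]
  · exact hF.imp_left fun h => h.2.mul h.1

theorem cellwise_symm (U : CellUnitary B B') (h : Infinite L → FixesQuiescent U.mat) :
    (cellwise (L := L) U h).symm =
      cellwise U.symm fun hL => (h hL).symm := by
  classical
  have key : (cellwise (L := L) U h).trans
      (cellwise U.symm fun hL => (h hL).symm) = .refl ℂ _ := by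
    rw [cellwise_comp]
    refine eq_of_forall_ket fun c => ?_
    ext c'
    obtain ⟨F, hcF, hF⟩ := exists_good_finset h (c.support ∪ c'.support)
    have hc := Finset.union_subset_left hcF
    have hc' := Finset.union_subset_right hcF
    rw [cellwise_ket_apply, cellwiseEntry_eq_prod (F := F) ?_ hc' hc]
    · change ∏ x ∈ F, (U.matᴴ * U.mat) (c' x) (c x) = _
      rw [U.conjTranspose_mul, prod_one_apply hc' hc]
      exact (ket_apply c c').symm
    · exact hF.imp_left fun h => (U.fixes_conjTranspose h).mul h
  ext1 ψ
  have e := congrArg (fun V : Space L B ≃ₗᵢ[ℂ] Space L B => V ((cellwise U h).symm ψ)) key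
  simpa using e.symm

end Cellwise

/-! ### Inverses of advections and of lattice gases. -/

theorem advection_symm {L J : Type} [AddCommGroup L] [Finite J] {B : J → Type}
    [∀ j, Zero (B j)] (e : J → L) :
    (advection (B := B) e).symm = advection fun j => -e j := by
  refine eq_of_forall_ket fun c => ?_
  rw [LinearIsometryEquiv.symm_apply_eq]
  simp only [advection, relabel_ket, Equiv.coe_fn_mk]
  congr 1
  ext x j
  simp [advectConfig_apply]

theorem advection_symm_apply {L J : Type} [AddCommGroup L] [Finite J] {B : J → Type}
    [∀ j, Zero (B j)] (e : J → L) (ψ : Space L (∀ j, B j)) (c : L →₀ ∀ j, B j) :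
    (advection e).symm ψ c = ψ (advectConfig e c) :=
  relabel_symm_apply _ ψ c

section QLGA

variable {L B : Type} [AddCommGroup L] [Fintype B] [DecidableEq B] [Zero B]
  {G : Space L B ≃ₗᵢ[ℂ] Space L B}

/-- The inverse of `Ŝ σ` is `σ⁻¹ Ŝ⁻¹`, with the factors in the wrong order; conjugating by `Ŝ⁻¹`
turns it into `Ŝ⁻¹ σ⁻¹`. Hence the change of description is `S⁻¹ T` in place of `T`. -/
theorem IsQLGA.symm (h : IsQLGA G) : IsQLGA G.symm := by
  obtain ⟨d, k, e, T, S, hT, hS, hG⟩ := h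
  have hS' : Infinite L → FixesQuiescent S.symm.mat := fun hL => (hS hL).symm
  refine ⟨d, k, fun j => -e j, S.symm.comp T, S.symm, fun hL => (hS' hL).comp (hT hL), hS',
    fun ψ => ?_⟩
  have e1 : cellwise (L := L) (S.symm.comp T) (fun hL => (hS' hL).comp (hT hL))
      = (cellwise T hT).trans (cellwise S hS).symm := by
    rw [cellwise_symm, cellwise_comp]
  rw [e1, ← cellwise_symm S hS, ← advection_symm, LinearIsometryEquiv.trans_apply,
    LinearIsometryEquiv.trans_apply]
  congr 1
  rw [LinearIsometryEquiv.eq_symm_apply, LinearIsometryEquiv.eq_symm_apply, ← hG,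
    LinearIsometryEquiv.apply_symm_apply]

/-- The matrix entries of the inverse of a QLGA, in the cell basis of the gas on one side. -/
theorem cellwise_symm_ket_apply {d : ℕ} {k : Fin d → ℕ} {e : Fin d → L}
    {T : CellUnitary B (∀ j, Fin (k j + 1))}
    {S : CellUnitary (∀ j, Fin (k j + 1)) (∀ j, Fin (k j + 1))}
    {hT : Infinite L → FixesQuiescent T.mat} {hS : Infinite L → FixesQuiescent S.mat}
    (hG : ∀ ψ, cellwise T hT (G ψ) = cellwise S hS (advection e (cellwise T hT ψ)))
    (u : L →₀ B) (c : L →₀ ∀ j, Fin (k j + 1)) :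
    cellwise T hT (G.symm (ket u)) c
      = cellwiseEntry (S.matᴴ * T.mat) (advectConfig e c) u := by
  have h1 := hG (G.symm (ket u))
  rw [G.apply_symm_apply, ← LinearIsometryEquiv.symm_apply_eq,
    ← LinearIsometryEquiv.symm_apply_eq, cellwise_symm] at h1
  rw [← h1, advection_symm_apply, ← LinearIsometryEquiv.trans_apply, cellwise_comp,
    cellwise_ket_apply]
  rfl

end QLGA

/-! ### Factoring a sesquilinear form by an exchange between two copies. -/

section Exchange

/-- The sesquilinear form with kernel `K`. -/
def kernelForm {V : Type*} [Fintype V] (K : V → V → ℂ) (f g : V → ℂ) : ℂ :=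
  ∑ c, ∑ d, star (f c) * K c d * g d

theorem kernelForm_mul {V : Type*} [Fintype V] (K : V → V → ℂ) (f g f' g' : V → ℂ) :
    kernelForm K f g * kernelForm K f' g' = ∑ p : V × V, ∑ q : V × V,
      star (f p.1 * f' p.2) * (K p.1 q.1 * K p.2 q.2) * (g q.1 * g' q.2) := by
  rw [kernelForm, kernelForm, Finset.sum_mul_sum, Fintype.sum_prod_type]
  refine Finset.sum_congr rfl fun c _ => Finset.sum_congr rfl fun c' _ => ?_
  rw [Finset.sum_mul_sum, Fintype.sum_prod_type]
  refine Finset.sum_congr rfl fun d _ => Finset.sum_congr rfl fun d' _ => ?_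
  rw [star_mul']
  ring

/-- If the factorization of the configuration space behind `μ`, which exchanges one factor between
two configurations, splits the kernel, the reference vector `ω` and the vectors `f` and `g`, and `f`
and `g` differ from `ω` in different factors only, then the form of `f` and `g` factors. -/
theorem kernelForm_exchange {V : Type*} [Fintype V] (μ : V × V ≃ V × V) {K : V → V → ℂ}
    {f g ω : V → ℂ}
    (hK : ∀ p q, K (μ p).1 (μ q).1 * K (μ p).2 (μ q).2 = K p.1 q.1 * K p.2 q.2)
    (hf : ∀ p, f (μ p).1 * ω (μ p).2 = f p.1 * ω p.2)
    (hg : ∀ p, g (μ p).1 * ω (μ p).2 = ω p.1 * g p.2) :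
    kernelForm K f g * kernelForm K ω ω = kernelForm K f ω * kernelForm K ω g := by
  -- Both sides are forms on the doubled space, with vectors `f ⊗ ω`, `g ⊗ ω` on the left and `f ⊗
  -- ω`, `ω ⊗ g` on the right. The exchange preserves the kernel and `f ⊗ ω`, and turns `g ⊗ ω` into
  -- `ω ⊗ g`.
  rw [kernelForm_mul, kernelForm_mul, ← μ.sum_comp]
  refine Finset.sum_congr rfl fun p _ => ?_
  rw [← μ.sum_comp]
  refine Finset.sum_congr rfl fun q _ => ?_
  rw [hK, hf, hg]

end Exchange

/-! ### Exchanging the subcells that are advected to one cell. -/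

section Mix

variable {L J : Type} [AddCommGroup L] [Finite L] {B : J → Type} [∀ j, Zero (B j)]

open Classical in
/-- The configuration that agrees with `c` on the subcells that the advection `e` carries to the
cell `Y`, and with `c'` elsewhere. -/
def mix (e : J → L) (Y : L) (c c' : L →₀ ∀ j, B j) : L →₀ ∀ j, B j :=
  Finsupp.equivFunOnFinite.symm fun x j => if x = Y + e j then c x j else c' x j

open Classical in
theorem mix_apply (e : J → L) (Y : L) (c c' : L →₀ ∀ j, B j) (x : L) (j : J) :
    mix e Y c c' x j = if x = Y + e j then c x j else c' x j := rfl

theorem mix_mix (e : J → L) (Y : L) (c c' : L →₀ ∀ j, B j) :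
    mix e Y (mix e Y c c') (mix e Y c' c) = c := by
  ext x j
  simp only [mix_apply]
  split_ifs <;> rfl

/-- The exchange of the subcells that the advection `e` carries to the cell `Y`. -/
def mixEquiv (e : J → L) (Y : L) :
    (L →₀ ∀ j, B j) × (L →₀ ∀ j, B j) ≃ (L →₀ ∀ j, B j) × (L →₀ ∀ j, B j) where
  toFun p := (mix e Y p.1 p.2, mix e Y p.2 p.1)
  invFun p := (mix e Y p.1 p.2, mix e Y p.2 p.1)
  left_inv p := by simp only [mix_mix]
  right_inv p := by simp only [mix_mix]

variable [Finite J]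

theorem advectConfig_mix (e : J → L) (Y : L) (c c' : L →₀ ∀ j, B j) :
    advectConfig e (mix e Y c c') Y = advectConfig e c Y := by
  ext j
  simp [advectConfig_apply, mix_apply]

theorem advectConfig_mix_of_ne (e : J → L) {Y y : L} (h : y ≠ Y) (c c' : L →₀ ∀ j, B j) :
    advectConfig e (mix e Y c c') y = advectConfig e c' y := by
  ext j
  simp [advectConfig_apply, mix_apply, h]

/-- After advection the exchange swaps the whole cell `Y` and nothing else, so two states that are
products over advected cells merely trade their factors at `Y`. -/
theorem prod_advectConfig_mix [Fintype L] [DecidableEq L] (e : J → L) (Y : L)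
    (p q : L → (∀ j, B j) → ℂ) (c c' : L →₀ ∀ j, B j) :
    (∏ y, p y (advectConfig e (mix e Y c c') y)) * ∏ y, q y (advectConfig e (mix e Y c' c) y)
      = (∏ y, Function.update q Y (p Y) y (advectConfig e c y))
        * ∏ y, Function.update p Y (q Y) y (advectConfig e c' y) := by
  rw [← Finset.prod_mul_distrib, ← Finset.prod_mul_distrib]
  refine Finset.prod_congr rfl fun y _ => ?_
  by_cases h : y = Y
  · subst h
    simp only [advectConfig_mix, Function.update_self]
  · simp only [advectConfig_mix_of_ne e h, Function.update_of_ne h]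
    ring

/-- A product state whose advection is a product state is, in every cell, a product over the groups
of subcells that are advected by the same amount. -/
theorem mul_eq_of_prod_mix [Fintype L] [DecidableEq L] (e : J → L) (Y : L)
    {t : (∀ j, B j) → ℂ} (c₀ : L →₀ ∀ j, B j) (h₀ : ∏ x, t (c₀ x) ≠ 0)
    (h : ∀ c c' : L →₀ ∀ j, B j, (∏ x, t (mix e Y c c' x)) * ∏ x, t (mix e Y c' c x)
      = (∏ x, t (c x)) * ∏ x, t (c' x)) (c c' : L →₀ ∀ j, B j) (x : L) :
    t (mix e Y c c' x) * t (mix e Y c' c x) = t (c x) * t (c' x) := by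
  classical
  -- All cells but `x` are frozen at `c₀` in both copies. The exchange does not alter them, and they
  -- contribute a common nonzero factor that cancels.
  have hu : ∀ a : ∀ j, B j, ∏ y, t (Finsupp.update c₀ x a y)
      = t a * ∏ y ∈ Finset.univ.erase x, t (c₀ y) := by
    intro a
    rw [← Finset.mul_prod_erase _ _ (Finset.mem_univ x)]
    congr 1
    · simp
    · refine Finset.prod_congr rfl fun y hy => ?_
      simp [Function.update_of_ne (Finset.ne_of_mem_erase hy)]
  have hm : ∀ c c' : L →₀ ∀ j, B j, mix e Y (Finsupp.update c₀ x (c x))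
      (Finsupp.update c₀ x (c' x)) = Finsupp.update c₀ x (mix e Y c c' x) := by
    intro c c'
    ext y j
    by_cases hy : y = x
    · subst hy
      simp [mix_apply]
    · simp [mix_apply, Function.update_of_ne hy]
  have hk : ∏ y ∈ Finset.univ.erase x, t (c₀ y) ≠ 0 := by
    rw [← Finset.mul_prod_erase _ _ (Finset.mem_univ x)] at h₀
    exact right_ne_zero_of_mul h₀
  have e1 := h (Finsupp.update c₀ x (c x)) (Finsupp.update c₀ x (c' x))
  rw [hm, hm, hu, hu, hu, hu] at e1
  refine mul_right_cancel₀ (mul_ne_zero hk hk) ?_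
  linear_combination e1

end Mix

/-! ### The overlap of two vectors within one cell. -/

section Overlap

variable {L B B' : Type} [Fintype B] [Fintype B'] [DecidableEq B] [DecidableEq B'] [Zero B]
  [Zero B']

/-- The inner product of the components of two vectors on the configurations in which all cells
other than `X` are quiescent. -/
def overlap (X : L) (ψ φ : Space L B) : ℂ :=
  ∑ a, star (ψ (Finsupp.single X a)) * φ (Finsupp.single X a)

theorem cellwise_ket_single (T : CellUnitary B B') (hT : FixesQuiescent T.mat) (X : L) (a : B) :
    cellwise T (fun _ => hT) (ket (Finsupp.single X a))
      = ∑ a', T.mat a' a • ket (Finsupp.single X a') := by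
  classical
  have hX : ∀ {B : Type} [Zero B] (a : B), (Finsupp.single X a).support ⊆ {X} :=
    fun a => Finsupp.support_single_subset
  rw [cellwise_ket_eq_sum (F := {X}) T _ (Or.inl hT) (hX a)]
  refine Finset.sum_nbij' (fun c => c X) (fun a' => Finsupp.single X a') (by simp) ?_ ?_ (by simp)
    ?_
  · intro a' _
    exact mem_configsOn.2 (hX a')
  · intro c hc
    exact (Finsupp.support_subset_singleton.1 (mem_configsOn.1 hc)).symm
  · intro c hc
    rw [mem_configsOn] at hc
    rw [cellwiseEntry_eq_prod (Or.inl hT) hc (hX a), Finset.prod_singleton,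
      Finsupp.single_eq_same, ← Finsupp.support_subset_singleton.1 hc]

/-- Since `T` fixes the quiescent state, `T̂` maps the states that are quiescent off `X` among
themselves, acting there as the unitary `T` on the cell `X`. -/
theorem overlap_cellwise (T : CellUnitary B B') (hT : FixesQuiescent T.mat) (X : L)
    (ψ φ : Space L B) :
    overlap X (cellwise T (fun _ => hT) ψ) (cellwise T (fun _ => hT) φ) = overlap X ψ φ := by
  have h : ∀ (ψ : Space L B) (a : B), ψ (Finsupp.single X a)
      = ∑ a', T.matᴴ a a' * cellwise T (fun _ => hT) ψ (Finsupp.single X a') := by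
    intro ψ a
    rw [← inner_ket_left, ← (cellwise T fun _ => hT).inner_map_map, cellwise_ket_single, sum_inner]
    refine Finset.sum_congr rfl fun a' _ => ?_
    rw [inner_smul_left, inner_ket_left]
    rfl
  set x : B' → ℂ := fun a' => cellwise T (fun _ => hT) ψ (Finsupp.single X a') with hx
  set y : B' → ℂ := fun a' => cellwise T (fun _ => hT) φ (Finsupp.single X a') with hy
  have h1 : overlap X ψ φ = star (T.matᴴ *ᵥ x) ⬝ᵥ (T.matᴴ *ᵥ y) := by
    refine Finset.sum_congr rfl fun a _ => ?_
    rw [h ψ a, h φ a]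
    rfl
  rw [h1, Matrix.star_mulVec, ← Matrix.dotProduct_mulVec, Matrix.mulVec_mulVec,
    Matrix.conjTranspose_conjTranspose, T.mul_conjTranspose, Matrix.one_mulVec]
  rfl

/-- The condition on `Mᴴ` says that the quiescent row of `M` vanishes off the quiescent column, so
an excited cell acquires no quiescent component. -/
theorem cellwiseEntry_single_eq_zero {M : Matrix B' B ℂ} (hM : FixesQuiescent M)
    (hM' : FixesQuiescent Mᴴ) {Y : L} {b : B} (hb : b ≠ 0) {c : L →₀ B'} (hc : c Y = 0) :
    cellwiseEntry M c (Finsupp.single Y b) = 0 := by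
  have hY : (Finsupp.single Y b).support ⊆ {Y} := Finsupp.support_single_subset
  by_cases h : c.support ⊆ {Y}
  · rw [cellwiseEntry_eq_prod (Or.inl hM) h hY, Finset.prod_singleton, hc, Finsupp.single_eq_same]
    have := hM' b
    rw [if_neg hb, Matrix.conjTranspose_apply, star_eq_zero] at this
    exact this
  · exact cellwiseEntry_eq_zero (Or.inl hM) hY h

theorem eq_zero_of_cellwiseEntry_single_ne_zero {M : Matrix B' B ℂ} (hM : FixesQuiescent M)
    {Y y : L} {b : B} {c : L →₀ B'} (h : cellwiseEntry M c (Finsupp.single Y b) ≠ 0)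
    (hy : y ≠ Y) : c y = 0 := by
  have hY : (Finsupp.single Y b).support ⊆ {Y} := Finsupp.support_single_subset
  by_contra hc
  refine h (cellwiseEntry_eq_zero (Or.inl hM) hY fun hs => hy ?_)
  exact Finset.mem_singleton.1 (hs (Finsupp.mem_support_iff.2 hc))

end Overlap

/-! ### Orthogonality of evolved excitations in a lattice gas. -/

section QLGA

variable {L B : Type} [AddCommGroup L] [Fintype B] [DecidableEq B] [Zero B]
  {G : Space L B ≃ₗᵢ[ℂ] Space L B} {d : ℕ} {k : Fin d → ℕ} {e : Fin d → L}
  {T : CellUnitary B (∀ j, Fin (k j + 1))}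
  {S : CellUnitary (∀ j, Fin (k j + 1)) (∀ j, Fin (k j + 1))}

/-- In the gas basis the two vectors have disjoint supports: a configuration occurring in the first
is, once advected, excited at `Y`, while one occurring in the second is quiescent everywhere except
at `Y'`. -/
theorem overlap_symm_eq_zero_of_infinite [Infinite L] (hT : Infinite L → FixesQuiescent T.mat)
    (hS : Infinite L → FixesQuiescent S.mat)
    (hG : ∀ ψ, cellwise T hT (G ψ) = cellwise S hS (advection e (cellwise T hT ψ)))
    {Y Y' : L} (hY : Y ≠ Y') (X : L) {b b' : B} (hb : b ≠ 0) :
    overlap X (G.symm (ket (Finsupp.single Y b))) (G.symm (ket (Finsupp.single Y' b'))) = 0 := by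
  have hM : FixesQuiescent (S.matᴴ * T.mat) :=
    (S.fixes_conjTranspose (hS inferInstance)).mul (hT inferInstance)
  have hM' : FixesQuiescent (S.matᴴ * T.mat)ᴴ := by
    rw [Matrix.conjTranspose_mul, Matrix.conjTranspose_conjTranspose]
    exact (T.fixes_conjTranspose (hT inferInstance)).mul (hS inferInstance)
  rw [← overlap_cellwise T (hT inferInstance)]
  refine Finset.sum_eq_zero fun a _ => ?_
  rw [cellwise_symm_ket_apply hG, cellwise_symm_ket_apply hG]
  by_contra h
  have h1 := left_ne_zero_of_mul h
  have h2 := right_ne_zero_of_mul h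
  rw [Ne, star_eq_zero] at h1
  exact h1 (cellwiseEntry_single_eq_zero hM hM' hb
    (eq_zero_of_cellwiseEntry_single_ne_zero hM h2 hY))

/-- The overlap is the form of the projection onto states quiescent off `X`; the kernel is this
projection conjugated by `T̂`. In contrast to `overlap_cellwise`, `T` may move the quiescent state.
-/
theorem overlap_eq_kernelForm {B' : Type} [Fintype B'] [DecidableEq B'] [Zero B'] [Finite L]
    [Fintype (L →₀ B')] (T : CellUnitary B B') (hT : Infinite L → FixesQuiescent T.mat) (X : L)
    (ψ φ : Space L B) :
    overlap X ψ φ = kernelForm (fun c d => ∑ a, cellwiseEntry T.mat c (Finsupp.single X a)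
        * star (cellwiseEntry T.mat d (Finsupp.single X a)))
      (fun c => cellwise T hT ψ c) fun c => cellwise T hT φ c := by
  have h : ∀ (ψ : Space L B) (a : B), ψ (Finsupp.single X a)
      = ∑ c, star (cellwiseEntry T.mat c (Finsupp.single X a)) * cellwise T hT ψ c := by
    intro ψ a
    rw [← inner_ket_left, ← (cellwise T hT).inner_map_map, lp.inner_eq_tsum, tsum_fintype]
    refine Finset.sum_congr rfl fun c _ => ?_
    rw [cellwise_ket_apply, RCLike.inner_apply, mul_comm]
    rfl
  have h' : overlap X ψ φ = ∑ a, ∑ c, ∑ c',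
      star (cellwise T hT ψ c) * (cellwiseEntry T.mat c (Finsupp.single X a)
        * star (cellwiseEntry T.mat c' (Finsupp.single X a))) * cellwise T hT φ c' := by
    refine Finset.sum_congr rfl fun a _ => ?_
    rw [h ψ a, h φ a, star_sum, Finset.sum_mul_sum]
    refine Finset.sum_congr rfl fun c _ => Finset.sum_congr rfl fun c' _ => ?_
    rw [star_mul', star_star]
    ring
  rw [h', Finset.sum_comm, kernelForm]
  refine Finset.sum_congr rfl fun c _ => ?_
  rw [Finset.sum_comm]
  refine Finset.sum_congr rfl fun c' _ => ?_
  rw [Finset.mul_sum, Finset.sum_mul]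

/-- The conjugated projection is the identity on the cell `X`, by unitarity of `T`, and the rank-one
projection onto `T|q⟩` on every other cell. -/
theorem sum_cellwiseEntry_single {B' : Type} [Fintype B'] [DecidableEq B'] [Zero B'] [Fintype L]
    [DecidableEq L] (T : CellUnitary B B') (X : L) (c c' : L →₀ B') :
    ∑ a, cellwiseEntry T.mat c (Finsupp.single X a)
        * star (cellwiseEntry T.mat c' (Finsupp.single X a))
      = (if c X = c' X then 1 else 0)
        * ∏ x ∈ Finset.univ.erase X, (T.mat (c x) 0 * star (T.mat (c' x) 0)) := by
  have h : ∀ (c : L →₀ B') (a : B), cellwiseEntry T.mat c (Finsupp.single X a)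
      = T.mat (c X) a * ∏ x ∈ Finset.univ.erase X, T.mat (c x) 0 := by
    intro c a
    rw [cellwiseEntry_eq_prod (F := Finset.univ) (Or.inr Finset.mem_univ)
      (Finset.subset_univ _) (Finset.subset_univ _),
      ← Finset.mul_prod_erase _ _ (Finset.mem_univ X), Finsupp.single_eq_same]
    congr 1
    refine Finset.prod_congr rfl fun x hx => ?_
    rw [Finsupp.single_eq_of_ne (Finset.ne_of_mem_erase hx)]
  rw [← Matrix.one_apply, ← T.mul_conjTranspose, Matrix.mul_apply, Finset.sum_mul]
  refine Finset.sum_congr rfl fun a _ => ?_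
  rw [h, h, star_mul', star_prod, Finset.prod_mul_distrib, Matrix.conjTranspose_apply]
  ring

theorem overlap_symm_eq_zero_of_finite [Finite L] (hT : Infinite L → FixesQuiescent T.mat)
    (hS : Infinite L → FixesQuiescent S.mat)
    (hG : ∀ ψ, cellwise T hT (G ψ) = cellwise S hS (advection e (cellwise T hT ψ)))
    (hq : G (ket 0) = ket 0)
    {Y Y' : L} (hY : Y ≠ Y') (X : L) {b b' : B} (hb : b ≠ 0) :
    overlap X (G.symm (ket (Finsupp.single Y b))) (G.symm (ket (Finsupp.single Y' b'))) = 0 := by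
  classical
  have : Fintype L := Fintype.ofFinite L
  have : Fintype (L →₀ ∀ j, Fin (k j + 1)) :=
    Fintype.ofEquiv _ Finsupp.equivFunOnFinite.symm
  have hq' : G.symm (ket 0) = ket 0 := by rw [LinearIsometryEquiv.symm_apply_eq, hq]
  have hu : ∀ (u : L →₀ B) (c : L →₀ ∀ j, Fin (k j + 1)), cellwise T hT (G.symm (ket u)) c
      = ∏ y, (S.matᴴ * T.mat) (advectConfig e c y) (u y) := by
    intro u c
    rw [cellwise_symm_ket_apply hG, cellwiseEntry_eq_prod (F := Finset.univ)
      (Or.inr Finset.mem_univ) (Finset.subset_univ _) (Finset.subset_univ _)]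
  have hω : ∀ c : L →₀ ∀ j, Fin (k j + 1), cellwise T hT (ket 0) c = ∏ x, T.mat (c x) 0 := by
    intro c
    rw [cellwise_ket_apply, cellwiseEntry_eq_prod (F := Finset.univ)
      (Or.inr Finset.mem_univ) (Finset.subset_univ _) (Finset.subset_univ _)]
    rfl
  -- Because the vacuum is fixed, it is its own backward evolution, which gives a second product
  -- formula for it, over the advected cells.
  have hω' : ∀ c : L →₀ ∀ j, Fin (k j + 1), cellwise T hT (ket 0) c
      = ∏ y, (S.matᴴ * T.mat) (advectConfig e c y) 0 := by
    intro c
    rw [← hq', hu]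
    rfl
  obtain ⟨c₀, hc₀⟩ : ∃ c, cellwise T hT (ket (0 : L →₀ B)) c ≠ 0 := by
    by_contra! h
    have h1 : cellwise T hT (ket (0 : L →₀ B)) = 0 := by
      ext c
      exact h c
    have h2 : ket (0 : L →₀ B) = 0 := by simpa using h1
    have h3 : ket (0 : L →₀ B) 0 = 0 := by rw [h2]; rfl
    simp [ket_apply] at h3
  have ht : ∀ (c c' : L →₀ ∀ j, Fin (k j + 1)) (x : L),
      T.mat (mix e Y c c' x) 0 * T.mat (mix e Y c' c x) 0 = T.mat (c x) 0 * T.mat (c' x) 0 := by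
    refine mul_eq_of_prod_mix (t := fun a => T.mat a 0) e Y c₀ (by rw [← hω]; exact hc₀) ?_
    intro c c'
    rw [← hω, ← hω, ← hω, ← hω, hω', hω', hω', hω']
    have := prod_advectConfig_mix e Y (fun _ a => (S.matᴴ * T.mat) a 0)
      (fun _ a => (S.matᴴ * T.mat) a 0) c c'
    rw [Function.update_eq_self_iff.2 rfl] at this
    exact this
  -- Exchanging the group of `Y` is the right move: the first excitation differs from the vacuum
  -- only in that group, the second only outside it because `Y ≠ Y'`.
  have hex := kernelForm_exchange (mixEquiv e Y)
    (K := fun c d => ∑ a, cellwiseEntry T.mat c (Finsupp.single X a)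
        * star (cellwiseEntry T.mat d (Finsupp.single X a)))
    (f := fun c => cellwise T hT (G.symm (ket (Finsupp.single Y b))) c)
    (g := fun c => cellwise T hT (G.symm (ket (Finsupp.single Y' b'))) c)
    (ω := fun c => cellwise T hT (ket 0) c) ?_ ?_ ?_
  · simp only [← overlap_eq_kernelForm T hT] at hex
    have h1 : overlap X (ket (0 : L →₀ B)) (ket (0 : L →₀ B)) = 1 := by
      simp [overlap, ket_apply]
    -- Only the vacuum component could contribute, and it vanishes since `G` fixes the vacuum and `b
    -- ≠ 0`.
    have h2 : overlap X (G.symm (ket (Finsupp.single Y b))) (ket (0 : L →₀ B)) = 0 := by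
      refine Finset.sum_eq_zero fun a _ => ?_
      rw [ket_apply]
      split_ifs with h
      · rw [h, symm_ket_apply, hq, ket_apply, if_neg (by simpa using hb)]
        simp
      · rw [mul_zero]
    rw [h1, h2, mul_one, zero_mul] at hex
    exact hex
  · rintro ⟨c, c'⟩ ⟨a, a'⟩
    simp only [sum_cellwiseEntry_single, mixEquiv, Equiv.coe_fn_mk]
    -- Subcell by subcell, the exchange leaves the pair of equations alone or swaps them.
    have h1 : (mix e Y c c' X = mix e Y a a' X ∧ mix e Y c' c X = mix e Y a' a X)
        ↔ (c X = a X ∧ c' X = a' X) := by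
      simp only [funext_iff, mix_apply, ← forall_and]
      refine forall_congr' fun j => ?_
      split_ifs
      · rfl
      · exact and_comm
    rw [mul_mul_mul_comm, mul_mul_mul_comm (if c X = a X then (1 : ℂ) else 0),
      ← Finset.prod_mul_distrib, ← Finset.prod_mul_distrib]
    congr 1
    · simp only [ite_zero_mul_ite_zero, h1]
    · refine Finset.prod_congr rfl fun x _ => ?_
      have e1 := ht c c' x
      have e2 := congrArg star (ht a a' x)
      simp only [star_mul'] at e2
      linear_combination (star (T.mat (mix e Y a a' x) 0) * star (T.mat (mix e Y a' a x) 0)) * e1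
        + (T.mat (c x) 0 * T.mat (c' x) 0) * e2
  · rintro ⟨c, c'⟩
    simp only [mixEquiv, Equiv.coe_fn_mk, hu, hω']
    have := prod_advectConfig_mix e Y
      (fun y a => (S.matᴴ * T.mat) a (Finsupp.single Y b y))
      (fun _ a => (S.matᴴ * T.mat) a 0) c c'
    rw [this]
    congr 1 <;> refine Finset.prod_congr rfl fun y _ => ?_
    · by_cases h : y = Y
      · subst h; simp
      · simp [h]
    · by_cases h : y = Y
      · subst h; simp
      · simp [h]
  · rintro ⟨c, c'⟩
    simp only [mixEquiv, Equiv.coe_fn_mk, hu, hω']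
    have := prod_advectConfig_mix e Y
      (fun y a => (S.matᴴ * T.mat) a (Finsupp.single Y' b' y))
      (fun _ a => (S.matᴴ * T.mat) a 0) c c'
    rw [this]
    congr 1 <;> refine Finset.prod_congr rfl fun y _ => ?_
    · by_cases h : y = Y
      · subst h; simp [hY]
      · simp [h]
    · by_cases h : y = Y
      · subst h; simp [hY]
      · simp [h]

/-- In a QLGA, the backward evolutions of excitations of two different cells are orthogonal within
every cell. -/
theorem IsQLGA.overlap_symm_eq_zero (h : IsQLGA G) (hq : G (ket 0) = ket 0) {Y Y' : L}
    (hY : Y ≠ Y') (X : L) {b b' : B} (hb : b ≠ 0) :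
    overlap X (G.symm (ket (Finsupp.single Y b))) (G.symm (ket (Finsupp.single Y' b'))) = 0 := by
  obtain ⟨d, k, e, T, S, hT, hS, hG⟩ := h
  rcases finite_or_infinite L with hL | hL
  · exact overlap_symm_eq_zero_of_finite hT hS hG hq hY X hb
  · exact overlap_symm_eq_zero_of_infinite hT hS hG hY X hb

/-- In a QLGA, the evolutions of excitations of two different cells are orthogonal within every
cell. -/
theorem IsQLGA.overlap_eq_zero (h : IsQLGA G) (hq : G (ket 0) = ket 0) {Y Y' : L}
    (hY : Y ≠ Y') (X : L) {b b' : B} (hb : b ≠ 0) :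
    overlap X (G (ket (Finsupp.single Y b))) (G (ket (Finsupp.single Y' b'))) = 0 :=
  h.symm.overlap_symm_eq_zero (by rw [LinearIsometryEquiv.symm_apply_eq, hq]) hY X hb

end QLGA

/-! ### Sesquilinearity of the overlap and its values on basis vectors. -/

section Form

variable {L B : Type} [Fintype B] [DecidableEq B] [Zero B]

theorem overlap_add_left (X : L) (ψ ψ' φ : Space L B) :
    overlap X (ψ + ψ') φ = overlap X ψ φ + overlap X ψ' φ := by
  simp only [overlap, Space.add_apply, star_add, add_mul, Finset.sum_add_distrib]

theorem overlap_add_right (X : L) (ψ φ φ' : Space L B) :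
    overlap X ψ (φ + φ') = overlap X ψ φ + overlap X ψ φ' := by
  simp only [overlap, Space.add_apply, mul_add, Finset.sum_add_distrib]

theorem overlap_smul_left (X : L) (z : ℂ) (ψ φ : Space L B) :
    overlap X (z • ψ) φ = star z * overlap X ψ φ := by
  simp only [overlap, Space.smul_apply, star_mul', mul_assoc, Finset.mul_sum]

theorem overlap_smul_right (X : L) (z : ℂ) (ψ φ : Space L B) :
    overlap X ψ (z • φ) = z * overlap X ψ φ := by
  simp only [overlap, Space.smul_apply, Finset.mul_sum]
  exact Finset.sum_congr rfl fun _ _ => by ring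

theorem overlap_ket_single (X Y : L) {b : B} (hb : b ≠ 0) (c : L →₀ B)
    [Decidable (Finsupp.single Y b = c ∧ Y = X)] :
    overlap X (ket (Finsupp.single Y b)) (ket c)
      = if Finsupp.single Y b = c ∧ Y = X then 1 else 0 := by
  classical
  by_cases h : Y = X
  · subst h
    rw [overlap, Finset.sum_eq_single b]
    · simp [ket_apply]
    · intro a _ ha
      have : Finsupp.single Y a ≠ Finsupp.single Y b := fun h => ha (Finsupp.single_injective Y h)
      simp [ket_apply, this]
    · simp
  · rw [if_neg fun h' => h h'.2]
    refine Finset.sum_eq_zero fun a _ => ?_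
    have : Finsupp.single X a ≠ Finsupp.single Y b := by
      intro h'
      have h1 := DFunLike.congr_fun h' Y
      rw [Finsupp.single_eq_same, Finsupp.single_eq_of_ne h] at h1
      exact hb h1.symm
    simp [ket_apply, this]

theorem cellwise_ket_zero {B' : Type} [Fintype B'] [DecidableEq B'] [Zero B'] [Nonempty L]
    (T : CellUnitary B B') (hT : FixesQuiescent T.mat) :
    cellwise (L := L) T (fun _ => hT) (ket 0) = ket 0 := by
  obtain ⟨X⟩ := ‹Nonempty L›
  rw [← Finsupp.single_zero X, cellwise_ket_single]
  simp [hT _]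

end Form

/-! ### Advection of the vacuum and of single excitations. -/

section Advection

variable {L J : Type} [AddCommGroup L] [Finite J] {B : J → Type} [∀ j, Zero (B j)]

theorem advection_ket (e : J → L) (c : L →₀ ∀ j, B j) :
    advection e (ket c) = ket (advectConfig e c) :=
  relabel_ket _ c

theorem advection_ket_zero (e : J → L) :
    advection (B := B) e (ket 0) = ket 0 := by
  rw [advection_ket]
  congr 1
  ext x j
  rfl

theorem advection_ket_single [DecidableEq J] (e : J → L) (x : L) (j : J) (b : B j) :
    advection e (ket (Finsupp.single x (Pi.single j b)))
      = ket (Finsupp.single (x - e j) (Pi.single j b)) := by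
  classical
  rw [advection_ket]
  congr 1
  ext y l
  rw [advectConfig_apply, Finsupp.single_apply, Finsupp.single_apply]
  by_cases hl : l = j
  · subst hl
    have : x = y + e l ↔ x - e l = y := sub_eq_iff_eq_add.symm
    simp only [this]
  · split_ifs <;> simp [hl]

end Advection

/-! ### Single excitations seen in the new cells. -/

namespace CellConstruction

variable {N : ℕ} {J : Type} (C : CellConstruction N J)

/-- The new cell that contains the subcell `j` of the old cell `x`. -/
def cell (x : ZMod N) (j : J) : ZMod C.K := (C.siteEquiv.symm (x - C.c j)).1

/-- The position of the subcell `j` of the old cell `x` in its new cell. -/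
def position (x : ZMod N) (j : J) : Fin C.m × J := ((C.siteEquiv.symm (x - C.c j)).2, j)

theorem cell_surjective (j : J) : Function.Surjective fun x => C.cell x j := by
  intro y
  refine ⟨C.siteEquiv (y, ⟨0, C.m_pos⟩) + C.c j, ?_⟩
  simp [cell]

/-- Unit steps reach every site, so without a boundary all subcells of type `j` would share one new
cell; as every new cell contains such a subcell, there would be only one. -/
theorem exists_cell_ne (hK : C.K ≠ 1) (j : J) : ∃ z, C.cell z j ≠ C.cell (z + 1) j := by
  by_contra! h
  have h1 : ∀ n : ℤ, C.cell (n : ZMod N) j = C.cell 0 j := by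
    intro n
    induction n using Int.induction_on with
    | zero => simp
    | succ n ih => rw [← ih, h (n : ℤ)]; push_cast; rfl
    | pred n ih => rw [← ih, h ((-(n : ℤ) - 1 : ℤ) : ZMod N)]; push_cast; rw [sub_add_cancel]
  refine hK (ZMod.subsingleton_iff.1 ⟨fun y y' => ?_⟩)
  obtain ⟨x, rfl⟩ := C.cell_surjective j y
  obtain ⟨x', rfl⟩ := C.cell_surjective j y'
  obtain ⟨n, rfl⟩ := ZMod.intCast_surjective x
  obtain ⟨n', rfl⟩ := ZMod.intCast_surjective x'
  exact (h1 n).trans (h1 n').symm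

variable [Finite J] {B : J → Type} [∀ j, Zero (B j)]

theorem evolution_regroup (G : Space (ZMod N) (∀ j, B j) ≃ₗᵢ[ℂ] Space (ZMod N) (∀ j, B j))
    (ψ : Space (ZMod N) (∀ j, B j)) : C.evolution G (C.regroup ψ) = C.regroup (G ψ) := by
  simp [evolution]

theorem evolution_symm_regroup
    (G : Space (ZMod N) (∀ j, B j) ≃ₗᵢ[ℂ] Space (ZMod N) (∀ j, B j))
    (ψ : Space (ZMod N) (∀ j, B j)) :
    (C.evolution G).symm (C.regroup ψ) = C.regroup (G.symm ψ) := by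
  simp [LinearIsometryEquiv.symm_apply_eq, evolution_regroup]

theorem regroup_ket_zero : C.regroup (B := B) (ket 0) = ket 0 := by
  rw [regroup, relabel_ket]
  congr 1
  ext y p
  rfl

theorem regroup_ket_single [DecidableEq J] {β : Type} [Zero β] (x : ZMod N) (j : J) (b : β) :
    C.regroup (B := fun _ => β) (ket (Finsupp.single x (Pi.single j b)))
      = ket (Finsupp.single (C.cell x j) (Pi.single (C.position x j) b)) := by
  classical
  rw [regroup, relabel_ket]
  congr 1
  ext y ⟨i, l⟩
  change (Finsupp.single x (Pi.single j b) : ZMod N →₀ J → β) (C.site (y, i) + C.c l) l = _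
  rw [Finsupp.single_apply, Finsupp.single_apply]
  by_cases hl : l = j
  · subst hl
    have h : x = C.site (y, i) + C.c l ↔ C.cell x l = y ∧ C.position x l = (i, l) := by
      rw [← sub_eq_iff_eq_add]
      change _ = C.siteEquiv (y, i) ↔ _
      rw [← Equiv.symm_apply_eq, Prod.ext_iff, cell, position, Prod.ext_iff]
      simp
    by_cases h1 : C.cell x l = y
    · by_cases h2 : C.position x l = (i, l)
      · rw [if_pos (h.2 ⟨h1, h2⟩), if_pos h1, h2]
        simp
      · rw [if_neg fun h' => h2 (h.1 h').2, if_pos h1, Pi.single_eq_of_ne (Ne.symm h2),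
          Pi.zero_apply]
    · rw [if_neg fun h' => h1 (h.1 h').1, if_neg h1]
      rfl
  · have h2 : (i, l) ≠ C.position x j := fun h => hl (congrArg Prod.snd h)
    split_ifs <;> simp [hl, Pi.single_eq_of_ne h2]

end CellConstruction

/-! ### The model on one-particle states. -/

section Model

theorem index_bijective : Function.Bijective QubitPair.index := by decide

theorem sqrt_two_mul_self : ((√2 : ℝ) : ℂ) * ((√2 : ℝ) : ℂ) = 2 := by
  rw [← Complex.ofReal_mul, Real.mul_self_sqrt (by norm_num)]
  norm_num

theorem conjTranspose_mul_scatteringMatrix : scatteringMatrixᴴ * scatteringMatrix = 1 := by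
  have h2 := sqrt_two_mul_self
  have h0 : ((√2 : ℝ) : ℂ) ≠ 0 := left_ne_zero_of_mul (by rw [h2]; norm_num)
  rw [scatteringMatrix, Matrix.conjTranspose_submatrix,
    ← Matrix.submatrix_mul _ _ _ _ _ index_bijective]
  rw [← Matrix.submatrix_one _ index_bijective.1]
  congr 1
  ext i j
  fin_cases i <;> fin_cases j <;>
    simp [Matrix.mul_apply, Fin.sum_univ_four, Matrix.conjTranspose_apply] <;>
    field_simp <;> simp only [pow_two, h2, Complex.I_mul_I] <;> norm_num

/-- The scattering matrix as a unitary map of the cell space. -/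
def scattering : CellUnitary QubitPair QubitPair where
  mat := scatteringMatrix
  conjTranspose_mul := conjTranspose_mul_scatteringMatrix
  mul_conjTranspose := mul_eq_one_comm.1 conjTranspose_mul_scatteringMatrix

theorem fixesQuiescent_scatteringMatrix : FixesQuiescent scatteringMatrix := by
  have h : ∀ i : Fin 4, (!![1, 0, 0, 0;
      0, 1 / (√2 : ℝ), Complex.I / (√2 : ℝ), 0;
      0, Complex.I / (√2 : ℝ), 1 / (√2 : ℝ), 0;
      0, 0, 0, Complex.I] : Matrix (Fin 4) (Fin 4) ℂ) i 0 = if i = 0 then 1 else 0 := by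
    intro i
    fin_cases i <;> simp
  intro b
  have h0 : b = 0 ↔ b.index = 0 := index_bijective.1.eq_iff.symm
  simp only [h0]
  exact h b.index

theorem fixesQuiescent_scattering : FixesQuiescent scattering.mat :=
  fixesQuiescent_scatteringMatrix

variable {N : ℕ}

/-- The basis vector with a single particle, in the subcell `j` of the cell `x`. -/
def particle (x : ZMod N) (j : Fin 2) : Space (ZMod N) QubitPair :=
  ket (Finsupp.single x (Pi.single j 1))

theorem sum_qubitPair {M : Type*} [AddCommMonoid M] (f : QubitPair → M) :
    ∑ b, f b = f 0 + f (Pi.single 1 1) + f (Pi.single 0 1) + f 1 := by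
  rw [show (Finset.univ : Finset QubitPair) = {0, Pi.single 1 1, Pi.single 0 1, 1} by decide,
    Finset.sum_insert (by decide), Finset.sum_insert (by decide), Finset.sum_insert (by decide),
    Finset.sum_singleton]
  abel

theorem cellwise_scattering_particle (x : ZMod N) :
    cellwise scattering (fun _ => fixesQuiescent_scattering) (particle x 0)
        = (1 / (√2 : ℝ) : ℂ) • (particle x 0 + Complex.I • particle x 1) ∧
      cellwise scattering (fun _ => fixesQuiescent_scattering) (particle x 1)
        = (1 / (√2 : ℝ) : ℂ) • (particle x 1 + Complex.I • particle x 0) := by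
  have i0 : QubitPair.index 0 = 0 := by decide
  have i1 : QubitPair.index (Pi.single 1 1) = 1 := by decide
  have i2 : QubitPair.index (Pi.single 0 1) = 2 := by decide
  have i3 : QubitPair.index 1 = 3 := by decide
  constructor <;>
  · rw [particle, cellwise_ket_single _ fixesQuiescent_scattering, sum_qubitPair]
    simp only [scattering, scatteringMatrix, Matrix.submatrix_apply, i0, i1, i2, i3]
    simp [particle, smul_smul, div_eq_mul_inv, mul_comm]
    try abel

/-- The evolution with both scattering matrices equal to `scatteringMatrix`. -/
abbrev model (N : ℕ) : Space (ZMod N) QubitPair ≃ₗᵢ[ℂ] Space (ZMod N) QubitPair :=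
  twoLayer N scattering scattering fixesQuiescent_scattering fixesQuiescent_scattering

theorem model_ket_zero : model N (ket 0) = ket 0 := by
  simp only [model, twoLayer, LinearIsometryEquiv.trans_apply, advection_ket_zero]
  rw [cellwise_ket_zero, advection_ket_zero, cellwise_ket_zero]

theorem inv_sqrt_two_sq : (1 / (√2 : ℝ) : ℂ) * (1 / (√2 : ℝ) : ℂ) = 1 / 2 := by
  have h2 := sqrt_two_mul_self
  rw [div_mul_div_comm, h2, mul_one]

theorem model_particle_zero (x : ZMod N) :
    model N (particle x 0) = (1 / 2 : ℂ) • (particle (x - 1) 0 + Complex.I • particle (x - 1) 1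
      + Complex.I • particle x 1 + (-1 : ℂ) • particle x 0) := by
  have a1 : ∀ (x : ZMod N) (e : Fin 2 → ZMod N) (j : Fin 2),
      advection e (particle x j) = particle (x - e j) j :=
    fun x e j => advection_ket_single e x j _
  simp only [model, twoLayer, LinearIsometryEquiv.trans_apply, a1, map_smul, map_add,
    cellwise_scattering_particle, Matrix.cons_val_zero, Matrix.cons_val_one, sub_zero]
  linear_combination (norm := module) inv_sqrt_two_sq • (particle (x - 1) 0
    + Complex.I • particle (x - 1) 1 + Complex.I • particle x 1
    + (Complex.I * Complex.I) • particle x 0)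
    + (1 / 2 : ℂ) • Complex.I_mul_I • particle x 0

/-- The base point `x - 1` is chosen because `σ₁` brings this particle into the same cell as the one
in subcell `0` of `x`. The two scatter together, so their images involve the same four subcells and
their overlap is informative. -/
theorem model_particle_one (x : ZMod N) :
    model N (particle (x - 1) 1) = (1 / 2 : ℂ) • (particle x 1 + Complex.I • particle x 0
      + Complex.I • particle (x - 1) 0 + (-1 : ℂ) • particle (x - 1) 1) := by
  have a1 : ∀ (x : ZMod N) (e : Fin 2 → ZMod N) (j : Fin 2),
      advection e (particle x j) = particle (x - e j) j :=
    fun x e j => advection_ket_single e x j _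
  simp only [model, twoLayer, LinearIsometryEquiv.trans_apply, a1, map_smul, map_add,
    cellwise_scattering_particle, Matrix.cons_val_zero, Matrix.cons_val_one, sub_zero,
    sub_neg_eq_add, sub_add_cancel]
  linear_combination (norm := module) inv_sqrt_two_sq • (particle x 1
    + Complex.I • particle x 0 + Complex.I • particle (x - 1) 0
    + (Complex.I * Complex.I) • particle (x - 1) 1)
    + (1 / 2 : ℂ) • Complex.I_mul_I • particle (x - 1) 1

theorem model_symm_particle_zero (x : ZMod N) :
    (model N).symm (particle x 0) = (1 / 2 : ℂ) • (particle (x + 1) 0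
      + (-Complex.I) • particle x 1 + (-Complex.I) • particle (x - 1) 1
      + (-1 : ℂ) • particle x 0) := by
  have e1 := model_particle_one (x + 1)
  have e2 := model_particle_zero (x + 1)
  rw [add_sub_cancel_right] at e1 e2
  rw [LinearIsometryEquiv.symm_apply_eq]
  simp only [map_smul, map_add, model_particle_zero, model_particle_one, e1, e2]
  linear_combination (norm := module) (1 / 4 : ℂ) • Complex.I_mul_I • (particle (x + 1) 0
    + (2 : ℂ) • particle x 0 + particle (x - 1) 0)

theorem model_symm_particle_one (x : ZMod N) :
    (model N).symm (particle x 1) = (1 / 2 : ℂ) • (particle (x - 1) 1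
      + (-Complex.I) • particle x 0 + (-Complex.I) • particle (x + 1) 0
      + (-1 : ℂ) • particle x 1) := by
  have e1 := model_particle_one (x + 1)
  have e2 := model_particle_zero (x + 1)
  rw [add_sub_cancel_right] at e1 e2
  rw [LinearIsometryEquiv.symm_apply_eq]
  simp only [map_smul, map_add, model_particle_zero, model_particle_one, e1, e2]
  linear_combination (norm := module) (1 / 4 : ℂ) • Complex.I_mul_I • (particle (x + 1) 1
    + (2 : ℂ) • particle x 1 + particle (x - 1) 1)

open Classical in
/-- The indicator of the event that the subcell `j` of the old cell `x` is in the new cell `X`. -/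
def occupation (C : CellConstruction N (Fin 2)) (X : ZMod C.K) (x : ZMod N) (j : Fin 2) : ℂ :=
  if C.cell x j = X then 1 else 0

/-- Regrouping sends particles at distinct subcells to distinct basis vectors, so only diagonal
terms survive, weighted by whether the subcell lies in `X`. -/
theorem overlap_regroup_particle (C : CellConstruction N (Fin 2)) (X : ZMod C.K) (x y : ZMod N)
    (j l : Fin 2) :
    overlap X (C.regroup (particle x j)) (C.regroup (particle y l))
      = if x = y ∧ j = l then occupation C X x j else 0 := by
  classical
  have h1 : (1 : Fin 2) ≠ 0 := by decide
  have h2 : C.regroup (particle x j) = C.regroup (particle y l) ↔ x = y ∧ j = l := by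
    rw [C.regroup.injective.eq_iff]
    constructor
    · intro h
      have h' : particle y l (Finsupp.single x (Pi.single j 1)) = 1 := by
        rw [← h, particle, ket_apply, if_pos rfl]
      rw [particle, ket_apply] at h'
      split_ifs at h' with h3
      · have hx : x = y := by
          by_contra hne
          have := congrFun (DFunLike.congr_fun h3 x) j
          rw [Finsupp.single_eq_same, Finsupp.single_eq_of_ne hne, Pi.single_eq_same] at this
          exact h1 this
        subst hx
        refine ⟨rfl, ?_⟩
        by_contra hne
        have := congrFun (Finsupp.single_injective x h3) j
        rw [Pi.single_eq_same, Pi.single_eq_of_ne hne] at this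
        exact h1 this
      · exact absurd h' zero_ne_one
    · rintro ⟨rfl, rfl⟩
      rfl
  have h3 : ∀ c c' : ZMod C.K →₀ ∀ p : Fin C.m × Fin 2, Fin 2, c = c' ↔ ket c = ket c' := by
    intro c c'
    refine ⟨fun h => by rw [h], fun h => ?_⟩
    have := congrArg (fun ψ : Space _ _ => ψ c) h
    by_contra hne
    simp [ket_apply, hne] at this
  have h4 : ∀ (x : ZMod N) (j : Fin 2), C.regroup (particle x j)
      = ket (Finsupp.single (C.cell x j) (Pi.single (C.position x j) 1)) :=
    fun x j => C.regroup_ket_single x j 1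
  rw [h4, h4] at h2 ⊢
  rw [occupation, ← ite_and]
  refine (overlap_ket_single _ _ (by rw [Ne, Pi.single_eq_zero_iff]; exact h1) _).trans ?_
  exact if_congr (and_congr_left' ((h3 _ _).trans h2)) rfl rfl

/-! ### Occupation equations and the contradiction at a cell boundary. -/

variable (C : CellConstruction N (Fin 2))

theorem occupation_eq_of_symm (h : IsQLGA (C.evolution (model N))) (hN : (1 : ZMod N) ≠ 0)
    {x : ZMod N} (hx : C.cell x 0 ≠ C.cell x 1) (X : ZMod C.K) :
    occupation C X (x - 1) 1 + occupation C X x 0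
      = occupation C X (x + 1) 0 + occupation C X x 1 := by
  have h1 : (1 : Fin 2) ≠ 0 := by decide
  have hq : C.evolution (model N) (ket 0) = ket 0 := by
    rw [← C.regroup_ket_zero (B := fun _ => Fin 2), C.evolution_regroup, model_ket_zero]
  have key := h.overlap_symm_eq_zero hq hx X
    (b := Pi.single (M := fun _ : Fin C.m × Fin 2 => Fin 2) (C.position x 0) 1)
    (b' := Pi.single (M := fun _ : Fin C.m × Fin 2 => Fin 2) (C.position x 1) 1)
    (by rw [Ne, Pi.single_eq_zero_iff]; exact h1)
  rw [← C.regroup_ket_single x 0 1,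
    ← C.regroup_ket_single x 1 1] at key
  change overlap X ((C.evolution (model N)).symm (C.regroup (particle x 0)))
    ((C.evolution (model N)).symm (C.regroup (particle x 1))) = 0 at key
  rw [C.evolution_symm_regroup, C.evolution_symm_regroup, model_symm_particle_zero,
    model_symm_particle_one] at key
  simp only [map_smul, map_add, overlap_add_left, overlap_add_right, overlap_smul_left,
    overlap_smul_right, overlap_regroup_particle] at key
  have hx1 : x ≠ x - 1 := fun h => hN (by linear_combination h)
  simp [hN, hx1] at key
  -- The overlap is `I / 4` times the difference of the two sides; the multiple of `I` is cleared
  -- here.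
  linear_combination (-2 * Complex.I) * key + (occupation C X (x - 1) 1 + occupation C X x 0
    - (occupation C X (x + 1) 0 + occupation C X x 1)) * Complex.I_mul_I

theorem occupation_eq (h : IsQLGA (C.evolution (model N))) (hN : (1 : ZMod N) ≠ 0)
    {x : ZMod N} (hx : C.cell x 0 ≠ C.cell (x - 1) 1) (X : ZMod C.K) :
    occupation C X (x - 1) 0 + occupation C X (x - 1) 1
      = occupation C X x 1 + occupation C X x 0 := by
  have h1 : (1 : Fin 2) ≠ 0 := by decide
  have hq : C.evolution (model N) (ket 0) = ket 0 := by
    rw [← C.regroup_ket_zero (B := fun _ => Fin 2), C.evolution_regroup, model_ket_zero]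
  have key := h.overlap_eq_zero hq hx X
    (b := Pi.single (M := fun _ : Fin C.m × Fin 2 => Fin 2) (C.position x 0) 1)
    (b' := Pi.single (M := fun _ : Fin C.m × Fin 2 => Fin 2) (C.position (x - 1) 1) 1)
    (by rw [Ne, Pi.single_eq_zero_iff]; exact h1)
  rw [← C.regroup_ket_single x 0 1,
    ← C.regroup_ket_single (x - 1) 1 1] at key
  change overlap X (C.evolution (model N) (C.regroup (particle x 0)))
    (C.evolution (model N) (C.regroup (particle (x - 1) 1))) = 0 at key
  rw [C.evolution_regroup, C.evolution_regroup, model_particle_zero,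
    model_particle_one] at key
  simp only [map_smul, map_add, overlap_add_left, overlap_add_right, overlap_smul_left,
    overlap_smul_right, overlap_regroup_particle] at key
  have hx1 : x ≠ x - 1 := fun h => hN (by linear_combination h)
  simp [hN, hx1] at key
  linear_combination (-2 * Complex.I) * key + (occupation C X (x - 1) 0 + occupation C X (x - 1) 1
    - (occupation C X x 1 + occupation C X x 0)) * Complex.I_mul_I

theorem not_isQLGA_evolution_model (hK : C.K ≠ 1) : ¬ IsQLGA (C.evolution (model N)) := by
  classical
  intro h
  obtain ⟨z, hz⟩ := C.exists_cell_ne hK 0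
  have hN : (1 : ZMod N) ≠ 0 := fun h0 => hz (by rw [h0, add_zero])
  -- If both subcells of `z` lie in one new cell, the forward equation at `z + 1` for that cell has
  -- left side 2 and right side at most 1. Otherwise the backward equation at `z`, for the new cell
  -- of subcell `0`, has left side at least 1 and right side 0.
  by_cases h1 : C.cell z 0 = C.cell z 1
  · have key := occupation_eq C h hN (x := z + 1)
      (by rw [add_sub_cancel_right, ← h1]; exact hz.symm) (C.cell z 0)
    rw [add_sub_cancel_right] at key
    simp only [occupation] at key
    rw [if_pos trivial, if_pos h1.symm, if_neg hz.symm] at key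
    split_ifs at key <;> norm_num at key
  · have key := occupation_eq_of_symm C h hN h1 (C.cell z 0)
    simp only [occupation] at key
    rw [if_pos trivial, if_neg hz.symm, if_neg (Ne.symm h1)] at key
    split_ifs at key <;> norm_num at key

end Model

end QCA

end

theorem mainTheorem1 :
    ∃ (S₁ S₂ : QCA.CellUnitary QCA.QubitPair QCA.QubitPair)
      (h₁ : QCA.FixesQuiescent S₁.mat) (h₂ : QCA.FixesQuiescent S₂.mat),
      S₁.mat = QCA.scatteringMatrix ∧ S₂.mat = QCA.scatteringMatrix ∧
      ∀ (N : ℕ) (C : QCA.CellConstruction N (Fin 2)), C.K ≠ 1 →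
        ¬ QCA.IsQLGA (C.evolution (QCA.twoLayer N S₁ S₂ h₁ h₂)) :=
  ⟨QCA.scattering, QCA.scattering, QCA.fixesQuiescent_scattering,
    QCA.fixesQuiescent_scattering, rfl, rfl,
    fun _ C hK => QCA.not_isQLGA_evolution_model C hK⟩
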